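/- Let $L^2(0,1)$ be the real Hilbert space of square-integrable real functions on $(0,1)$ with Lebesgue measure. For an orthonormal system $\Phi=\{\phi_j\}_{j\in\mathbb N}\subset L^2(0,1)$ and an integer $n\ge 1$ put $$\kappa_n(\Phi)=\sup\frac{\bigl\|\max_{1\le m\le n}|p_m|\bigr\|_{2}}{\|p_n\|_{2}}\in[0,\infty],$$ where the supremum is over all sequences $p_k=\sum_{j\in G_k}c_j\phi_j$, $k=1,\dots,n$, with finite sets $G_1\subset G_2\subset\dots\subset G_n\subset\mathbb N$ and real numbers $c_j$ such that $\sum_{j\in G_n}c_j^2\ne 0$. Then there is an absolute constant $C>0$ such that for every complete orthonormal system $\Phi$ in $L^2(0,1)$ (that is, every orthonormal sequence whose linear span is dense in $L^2(0,1)$) and every integer $n\ge 1$, $$\kappa_n(\Phi)\ \ge\ C\,\sqrt{\log_2 n}.$$ -/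

import Mathlib

open MeasureTheory
open scoped ENNReal

/-- Lebesgue measure on the interval `(0,1)`. -/
noncomputable abbrev muUnit : Measure ℝ := volume.restrict (Set.Ioo (0 : ℝ) 1)

/-- The real Hilbert space `L²(0,1)`. -/
abbrev L2Unit : Type := Lp ℝ 2 muUnit

/-- A complete orthonormal system in `L²(0,1)`: an orthonormal sequence whose finite linear
combinations are dense. -/
structure IsCompleteOrthonormalSystem (Φ : ℕ → L2Unit) : Prop where
  orthonormal : Orthonormal ℝ Φ
  complete : (Submodule.span ℝ (Set.range Φ)).topologicalClosure = ⊤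

/-- The `Φ`-polynomial `∑_{j ∈ G} c_j φ_j` with finite index set `G`. -/
noncomputable def phiPolynomial (Φ : ℕ → L2Unit) (c : ℕ → ℝ) (G : Finset ℕ) : L2Unit :=
  ∑ j ∈ G, c j • Φ j

/-- The maximal function `x ↦ max_{1 ≤ m ≤ n} |p_m(x)|`, with values in `[0,∞]`. -/
noncomputable def maximalFunction (n : ℕ) (p : ℕ → L2Unit) (x : ℝ) : ℝ≥0∞ :=
  ⨆ m ∈ Finset.Icc 1 n, ‖p m x‖ₑ

/-- The pairs `(G, c)` that define the monotonic sequences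
`p_k = ∑_{j ∈ G_k} c_j φ_j`, `1 ≤ k ≤ n`: the finite sets satisfy `G_1 ⊆ ⋯ ⊆ G_n`, and
`∑_{j ∈ G_n} c_j² ≠ 0`. Only the values `G 1, …, G n` are used. -/
def IsMonotonicData (n : ℕ) (G : ℕ → Finset ℕ) (c : ℕ → ℝ) : Prop :=
  MonotoneOn G (Set.Icc 1 n) ∧ ∑ j ∈ G n, c j ^ 2 ≠ 0

/-- `κ_n(Φ)`: the supremum, in `[0,∞]`, of `‖max_{1 ≤ m ≤ n} |p_m|‖₂ / ‖p_n‖₂` over all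
monotonic sequences `p_1, …, p_n` of `Φ`-polynomials. -/
noncomputable def kappa (n : ℕ) (Φ : ℕ → L2Unit) : ℝ≥0∞ :=
  ⨆ (G : ℕ → Finset ℕ) (c : ℕ → ℝ) (_ : IsMonotonicData n G c),
    eLpNorm (maximalFunction n fun k => phiPolynomial Φ c (G k)) 2 muUnit /
      eLpNorm (phiPolynomial Φ c (G n)) 2 muUnit

/-!
Let `r` run through the Rademacher functions. Attach to each node of a full binary tree of depth `k`
a function `1_E r`, where `E` consists of the points whose branch passes through the node, and let a
branch turn right where `r = 1` and left where `r = -1`. In the in-order listing of the nodes, the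
values `+1` met by a point all come before its values `-1`. Hence at every point some partial sum
has absolute value at least `k / 3`, although the squared norms of the node functions only add up
to `k`.

As the Rademacher functions tend weakly to `0`, each node function can be chosen almost orthogonal
to any finite part of `Φ`. So it can be replaced, up to an arbitrarily small error and without
increasing its norm, by a polynomial that avoids the frequencies already used. The partial sums of
these fewer than `2 ^ k` polynomials form a monotonic sequence whose maximal function has norm
almost `k / 3`, while the whole sum has norm at most `√k` by Pythagoras.
-/

open Filter Finsupp
open scoped Function InnerProductSpace NNReal Topology

section DisjointSupport

variable {ι M : Type*} [AddMonoid M] {P : List (ι →₀ M)}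

lemma support_subset_support_list_sum (hP : P.Pairwise (Disjoint on Finsupp.support))
    {c : ι →₀ M} (hc : c ∈ P) : c.support ⊆ P.sum.support := by
  classical
  rw [P.support_sum_eq hP]
  exact fun i hi => List.mem_foldr_sup_support_iff.2 ⟨c, hc, hi⟩

lemma disjoint_support_list_sum {F : Finset ι} (hP : ∀ c ∈ P, Disjoint c.support F) :
    Disjoint P.sum.support F := by
  classical
  refine Finset.disjoint_left.2 fun i hi hiF => ?_
  obtain ⟨c, hcP, hic⟩ := List.mem_foldr_sup_support_iff.1 (P.support_sum_subset hi)
  exact Finset.disjoint_left.1 (hP c hcP) hic hiF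

lemma disjoint_support_sum_take_sum_drop (hP : P.Pairwise (Disjoint on Finsupp.support)) (m : ℕ) :
    Disjoint (P.take m).sum.support (P.drop m).sum.support := by
  rw [← P.take_append_drop m, List.pairwise_append] at hP
  exact disjoint_support_list_sum fun c hc =>
    (disjoint_support_list_sum fun d hd => (hP.2.2 c hc d hd).symm).symm

lemma sum_apply_of_mem_support_sum_take (hP : P.Pairwise (Disjoint on Finsupp.support)) {m : ℕ}
    {i : ι} (hi : i ∈ (P.take m).sum.support) : P.sum i = (P.take m).sum i := by
  have hdrop : (P.drop m).sum i = 0 := Finsupp.notMem_support_iff.1 <|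
    Finset.disjoint_left.1 (disjoint_support_sum_take_sum_drop hP m) hi
  rw [← P.sum_take_add_sum_drop m, Finsupp.add_apply, hdrop, add_zero]

lemma support_sum_take_subset (hP : P.Pairwise (Disjoint on Finsupp.support)) (m : ℕ) :
    (P.take m).sum.support ⊆ P.sum.support := fun i hi => by
  rw [Finsupp.mem_support_iff, sum_apply_of_mem_support_sum_take hP hi]
  exact Finsupp.mem_support_iff.1 hi

lemma monotone_support_sum_take (hP : P.Pairwise (Disjoint on Finsupp.support)) :
    Monotone fun m => (P.take m).sum.support := fun m l hml => by
  simpa only [List.take_take, min_eq_left hml] using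
    support_sum_take_subset (hP.sublist (List.take_sublist l P)) m

end DisjointSupport

section Hilbert

variable {ι 𝕜 H : Type*} [RCLike 𝕜] [NormedAddCommGroup H] [InnerProductSpace 𝕜 H]

lemma tendsto_inner_cofinite_of_orthonormal {v : ι → H} (hv : Orthonormal 𝕜 v) (x : H) :
    Tendsto (fun i => ⟪v i, x⟫_𝕜) cofinite (𝓝 0) := by
  have hsq := (hv.inner_products_summable x).tendsto_cofinite_zero.sqrt
  simp only [Real.sqrt_sq (norm_nonneg _), Real.sqrt_zero] at hsq
  exact tendsto_zero_iff_norm_tendsto_zero.2 hsq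

lemma inner_linearCombination_eq_zero_of_disjoint {v : ι → H} (hv : Orthonormal 𝕜 v)
    {c d : ι →₀ 𝕜} (hcd : Disjoint c.support d.support) :
    ⟪linearCombination 𝕜 v c, linearCombination 𝕜 v d⟫_𝕜 = 0 := by
  rw [hv.inner_finsupp_eq_sum_left]
  refine Finset.sum_eq_zero fun i hi => ?_
  have hdi : d i = 0 := Finsupp.notMem_support_iff.1 (Finset.disjoint_left.1 hcd hi)
  simp only [hdi, mul_zero]

lemma enorm_add_sq_of_inner_eq_zero {x y : H} (h : ⟪x, y⟫_𝕜 = 0) :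
    ‖x + y‖ₑ ^ 2 = ‖x‖ₑ ^ 2 + ‖y‖ₑ ^ 2 := by
  have hpyth := norm_add_sq_eq_norm_sq_add_norm_sq_of_inner_eq_zero x y h
  simp only [← sq] at hpyth
  simp only [← ofReal_norm, ← ENNReal.ofReal_pow (norm_nonneg _), hpyth,
    ENNReal.ofReal_add (sq_nonneg _) (sq_nonneg _)]

lemma enorm_sq_linearCombination_list_sum {v : ι → H} (hv : Orthonormal 𝕜 v)
    {P : List (ι →₀ 𝕜)} (hP : P.Pairwise (Disjoint on Finsupp.support)) :
    ‖linearCombination 𝕜 v P.sum‖ₑ ^ 2 =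
      (P.map fun c => ‖linearCombination 𝕜 v c‖ₑ ^ 2).sum := by
  induction P with
  | nil => simp
  | cons c P ih =>
    obtain ⟨hcP, hP⟩ := List.pairwise_cons.1 hP
    have horth := inner_linearCombination_eq_zero_of_disjoint hv
      (disjoint_support_list_sum fun d hd => (hcP d hd).symm).symm
    rw [List.sum_cons, List.map_cons, List.sum_cons, map_add, ← ih hP,
      enorm_add_sq_of_inner_eq_zero horth]

lemma norm_sum_inner_smul_le {v : ι → H} (hv : Orthonormal 𝕜 v) (x : H) (s : Finset ι) :
    ‖∑ i ∈ s, ⟪v i, x⟫_𝕜 • v i‖ ≤ ‖x‖ := by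
  refine le_of_sq_le_sq ((le_of_eq ?_).trans (hv.sum_inner_products_le x (s := s))) (norm_nonneg x)
  have hinner := hv.inner_sum (fun i => ⟪v i, x⟫_𝕜) (fun i => ⟪v i, x⟫_𝕜) s
  simp only [inner_self_eq_norm_sq_to_K, RCLike.conj_mul] at hinner
  exact_mod_cast hinner

lemma exists_linearCombination_near (b : HilbertBasis ι 𝕜 H) (x : H) (F : Finset ι) {ε : ℝ}
    (hF : ‖∑ i ∈ F, ⟪b i, x⟫_𝕜 • b i‖ < ε) :
    ∃ c : ι →₀ 𝕜, Disjoint c.support F ∧ ‖linearCombination 𝕜 b c‖ ≤ ‖x‖ ∧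
      ‖linearCombination 𝕜 b c - x‖ < ε := by
  classical
  have hsum : Tendsto (fun s => ‖(∑ i ∈ s, ⟪b i, x⟫_𝕜 • b i) - ∑ i ∈ F, ⟪b i, x⟫_𝕜 • b i - x‖)
      atTop (𝓝 ‖∑ i ∈ F, ⟪b i, x⟫_𝕜 • b i‖) := by
    have h := b.hasSum_repr x
    simp only [b.repr_apply_apply] at h
    simpa using ((h.sub_const (∑ i ∈ F, ⟪b i, x⟫_𝕜 • b i)).sub_const x).norm
  obtain ⟨s, hs, hFs⟩ := ((hsum.eventually_lt_const hF).and (eventually_ge_atTop F)).exists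
  let c : ι →₀ 𝕜 := Finsupp.indicator (s \ F) fun i _ => ⟪b i, x⟫_𝕜
  have hc : linearCombination 𝕜 b c = ∑ i ∈ s \ F, ⟪b i, x⟫_𝕜 • b i := by
    rw [linearCombination_apply]
    exact Finsupp.sum_indicator_index _ (by simp)
  refine ⟨c, Finset.disjoint_of_subset_left (Finsupp.support_indicator_subset _ _)
    Finset.sdiff_disjoint, ?_, ?_⟩
  · rw [hc]
    exact norm_sum_inner_smul_le b.orthonormal x _
  · rwa [hc, Finset.sum_sdiff_eq_sub hFs]

end Hilbert

section SignTree

variable {Ω : Type*} [MeasurableSpace Ω]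

/-- The functions attached to the nodes of a full binary tree of depth `k`, listed in in-order.
A node carries a sign function `r` restricted to a set `E`; its left subtree lives on the part of
`E` where `r = -1`, its right subtree on the part where `r = 1`. -/
inductive IsSignTree : ℕ → Set Ω → List (Ω → ℝ) → Prop
  | nil (E : Set Ω) : IsSignTree 0 E []
  | node {k : ℕ} {E : Set Ω} {r : Ω → ℝ} {L₁ L₂ : List (Ω → ℝ)} (hr : Measurable r)
      (hsign : ∀ x, r x = 1 ∨ r x = -1) (h₁ : IsSignTree k (E \ r ⁻¹' {1}) L₁)
      (h₂ : IsSignTree k (E ∩ r ⁻¹' {1}) L₂) : IsSignTree (k + 1) E (L₁ ++ E.indicator r :: L₂)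

lemma eLpNorm_sq_indicator_of_sign {r : Ω → ℝ} (hr : ∀ x, r x = 1 ∨ r x = -1) (μ : Measure Ω)
    {E : Set Ω} (hE : MeasurableSet E) : eLpNorm (E.indicator r) 2 μ ^ 2 = μ E := by
  have hnorm : ∀ x, ‖E.indicator r x‖ = ‖E.indicator (fun _ => (1 : ℝ)) x‖ := fun x => by
    rcases hr x with h | h <;> by_cases hx : x ∈ E <;> simp [hx, h]
  rw [eLpNorm_congr_norm_ae (ae_of_all μ hnorm),
    eLpNorm_indicator_const hE two_ne_zero ENNReal.ofNat_ne_top, enorm_one, one_mul,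
    ← ENNReal.rpow_natCast, ← ENNReal.rpow_mul]
  norm_num

namespace IsSignTree

variable {k : ℕ} {E : Set Ω} {L : List (Ω → ℝ)} {x : Ω}

lemma length_add_one (h : IsSignTree k E L) : L.length + 1 = 2 ^ k := by
  induction h with
  | nil => simp
  | node _ _ _ _ ih₁ ih₂ => rw [List.length_append, List.length_cons, pow_succ]; lia

lemma sum_apply_of_notMem (h : IsSignTree k E L) (hx : x ∉ E) : L.sum x = 0 := by
  induction h with
  | nil => simp
  | node _ _ _ _ ih₁ ih₂ =>
    simp [hx, ih₁ fun hx₁ => hx hx₁.1, ih₂ fun hx₂ => hx hx₂.1]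

/-- On the branch of `x` all the values `+1` precede all the values `-1`, because a node with `+1`
precedes its right subtree and one with `-1` succeeds its left one. The prefix ends with the last
`+1`; as the branch has `k` nodes, there are `(k + L.sum x) / 2` values `+1`. -/
lemma exists_prefix_le_sum_apply (h : IsSignTree k E L) (hx : x ∈ E) :
    ∃ L', L' <+: L ∧ (k + L.sum x) / 2 ≤ L'.sum x := by
  induction h with
  | nil => exact ⟨[], List.prefix_rfl, by simp⟩
  | @node k E r L₁ L₂ _ hsign h₁ h₂ ih₁ ih₂ =>
    by_cases hr : r x = 1
    · obtain ⟨L', hL', hle⟩ := ih₂ ⟨hx, hr⟩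
      refine ⟨L₁ ++ E.indicator r :: L', by simpa using hL', ?_⟩
      have hL₁ : L₁.sum x = 0 := h₁.sum_apply_of_notMem fun hx₁ => hx₁.2 hr
      simp only [List.sum_append, List.sum_cons, Pi.add_apply, hL₁, Set.indicator_of_mem hx, hr]
      push_cast
      linarith
    · obtain ⟨L', hL', hle⟩ := ih₁ ⟨hx, hr⟩
      refine ⟨L', hL'.trans (List.prefix_append _ _), ?_⟩
      have hL₂ : L₂.sum x = 0 := h₂.sum_apply_of_notMem fun hx₂ => hr hx₂.2
      simp only [List.sum_append, List.sum_cons, Pi.add_apply, hL₂, Set.indicator_of_mem hx,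
        (hsign x).resolve_left hr]
      push_cast
      linarith

lemma exists_prefix_le_abs_sum_apply (h : IsSignTree k E L) (hx : x ∈ E) :
    ∃ L', L' <+: L ∧ (k : ℝ) / 3 ≤ |L'.sum x| := by
  by_cases hL : (k : ℝ) / 3 ≤ |L.sum x|
  · exact ⟨L, List.prefix_rfl, hL⟩
  · obtain ⟨L', hL', hle⟩ := h.exists_prefix_le_sum_apply hx
    refine ⟨L', hL', le_trans ?_ (le_abs_self _)⟩
    linarith [neg_abs_le (L.sum x)]

lemma le_iSup_enorm_sum_take_apply (h : IsSignTree k E L) (hx : x ∈ E) :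
    (k / 3 : ℝ≥0∞) ≤ ⨆ m, ‖(L.take m).sum x‖ₑ := by
  obtain ⟨L', hL', hle⟩ := h.exists_prefix_le_abs_sum_apply hx
  calc (k / 3 : ℝ≥0∞) = ENNReal.ofReal (k / 3) := by
        rw [ENNReal.ofReal_div_of_pos three_pos, ENNReal.ofReal_natCast, ENNReal.ofReal_ofNat]
    _ ≤ ‖(L.take L'.length).sum x‖ₑ := by
        rw [← List.prefix_iff_eq_take.1 hL', Real.enorm_eq_ofReal_abs]
        exact ENNReal.ofReal_le_ofReal hle
    _ ≤ ⨆ m, ‖(L.take m).sum x‖ₑ := le_iSup (fun m => ‖(L.take m).sum x‖ₑ) L'.length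

lemma sum_eLpNorm_sq (h : IsSignTree k E L) (μ : Measure Ω) (hE : MeasurableSet E) :
    (L.map fun f => eLpNorm f 2 μ ^ 2).sum = k * μ E := by
  induction h with
  | nil => simp
  | @node k E r L₁ L₂ hr hsign _ _ ih₁ ih₂ =>
    have hset : MeasurableSet (r ⁻¹' {1}) := hr (measurableSet_singleton 1)
    rw [List.map_append, List.sum_append, List.map_cons, List.sum_cons,
      eLpNorm_sq_indicator_of_sign hsign μ hE, ih₁ (hE.diff hset),
      ih₂ (hE.inter hset), ← measure_inter_add_sdiff E hset]
    push_cast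
    ring

end IsSignTree

end SignTree

section Approximation

variable {Ω ι : Type*} [MeasurableSpace Ω] {μ : Measure Ω}

/-- A sequence of measurable functions with values `±1` that tends weakly to `0` in `L²(μ)`, like
the Rademacher functions on the unit interval. -/
structure IsWeaklyNullSignSequence (μ : Measure Ω) (r : ℕ → Ω → ℝ) : Prop where
  measurable : ∀ n, Measurable (r n)
  eq_one_or_eq_neg_one : ∀ n x, r n x = 1 ∨ r n x = -1
  tendsto_integral_mul : ∀ g : Ω → ℝ, MemLp g 2 μ →
    Tendsto (fun n => ∫ x, r n x * g x ∂μ) atTop (𝓝 0)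

/-- The polynomial with coefficients `c` in the system `Φ` is an `ε`-approximation of `f` in `L²`
and has at most the norm of `f`, as do the orthogonal projections of `f`. -/
structure IsContractiveApproximation (Φ : ι → Lp ℝ 2 μ) (ε : ℝ≥0) (c : ι →₀ ℝ) (f : Ω → ℝ) :
    Prop where
  aestronglyMeasurable : AEStronglyMeasurable f μ
  eLpNorm_sub_le : eLpNorm (⇑(linearCombination ℝ Φ c) - f) 2 μ ≤ ε
  eLpNorm_le : eLpNorm (linearCombination ℝ Φ c) 2 μ ≤ eLpNorm f 2 μ

/-- The maximal function of the partial sums of the polynomials with coefficient vectors `P` in the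
system `Φ`. The partial sums `P.take m` stabilize at `m = P.length`. -/
noncomputable def maximalPartialSum (Φ : ι → Lp ℝ 2 μ) (P : List (ι →₀ ℝ)) (x : Ω) : ℝ≥0∞ :=
  ⨆ m, ‖linearCombination ℝ Φ (P.take m).sum x‖ₑ

lemma measurable_maximalPartialSum (Φ : ι → Lp ℝ 2 μ) (P : List (ι →₀ ℝ)) :
    Measurable (maximalPartialSum Φ P) :=
  Measurable.iSup fun _ => (Lp.stronglyMeasurable _).measurable.enorm

lemma maximalPartialSum_ae_eq_zero (Φ : ι → Lp ℝ 2 μ) {P : List (ι →₀ ℝ)}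
    (hP : P.Pairwise (Disjoint on Finsupp.support)) (h : P.sum = 0) :
    maximalPartialSum Φ P =ᵐ[μ] 0 := by
  have hzero (m : ℕ) : (P.take m).sum = 0 := by
    simpa [h] using support_sum_take_subset hP m
  filter_upwards [AEEqFun.coeFn_zero (μ := μ) (β := ℝ)] with x hx
  simp [maximalPartialSum, hzero, hx]

lemma inner_toLp_toLp {f g : Ω → ℝ} (hf : MemLp f 2 μ) (hg : MemLp g 2 μ) :
    ⟪hf.toLp f, hg.toLp g⟫_ℝ = ∫ x, f x * g x ∂μ := by
  rw [L2.inner_def]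
  refine integral_congr_ae ?_
  filter_upwards [hf.coeFn_toLp, hg.coeFn_toLp] with x hfx hgx
  rw [hfx, hgx, real_inner_eq_re_inner, mul_comm]
  rfl

lemma exists_isContractiveApproximation_indicator [IsFiniteMeasure μ]
    (Φ : HilbertBasis ι ℝ (Lp ℝ 2 μ)) {r : ℕ → Ω → ℝ} (hr : IsWeaklyNullSignSequence μ r)
    {E : Set Ω} (hE : MeasurableSet E) (F : Finset ι) {ε : ℝ≥0} (hε : 0 < ε) :
    ∃ n c, Disjoint c.support F ∧ IsContractiveApproximation Φ ε c (E.indicator (r n)) := by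
  have hmem (n : ℕ) : MemLp (E.indicator (r n)) 2 μ :=
    MemLp.indicator hE <| MemLp.of_bound (hr.measurable n).aestronglyMeasurable 1 <|
      ae_of_all _ fun x => by rcases hr.eq_one_or_eq_neg_one n x with h | h <;> simp [h]
  have hinner (i : ι) : Tendsto (fun n => ⟪Φ i, (hmem n).toLp⟫_ℝ) atTop (𝓝 0) := by
    refine (hr.tendsto_integral_mul _ ((Lp.memLp (Φ i)).indicator hE)).congr fun n => ?_
    rw [← Lp.toLp_coeFn (Φ i) (Lp.memLp _), inner_toLp_toLp]
    congr with x
    by_cases hx : x ∈ E <;> simp [hx, mul_comm]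
  have hproj : Tendsto (fun n => ‖∑ i ∈ F, ⟪Φ i, (hmem n).toLp⟫_ℝ • Φ i‖) atTop (𝓝 0) := by
    simpa using (tendsto_finsetSum F fun i _ => (hinner i).smul_const (Φ i)).norm
  obtain ⟨n, hn⟩ := (hproj.eventually_lt_const (NNReal.coe_pos.2 hε)).exists
  obtain ⟨c, hcF, hc_norm, hc_near⟩ := exists_linearCombination_near Φ _ F hn
  refine ⟨n, c, hcF, (hmem n).1, ?_, ?_⟩
  · have hcoe : ⇑(linearCombination ℝ Φ c) - E.indicator (r n) =ᵐ[μ]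
        ⇑(linearCombination ℝ Φ c - (hmem n).toLp) := by
      filter_upwards [Lp.coeFn_sub (linearCombination ℝ Φ c) (hmem n).toLp,
        (hmem n).coeFn_toLp] with x hsub hx
      rw [hsub, Pi.sub_apply, Pi.sub_apply, hx]
    rw [eLpNorm_congr_ae hcoe, ← Lp.enorm_def, enorm_le_coe]
    exact hc_near.le
  · rw [← Lp.enorm_def, ← Lp.enorm_toLp (hf := hmem n)]
    exact enorm_le_iff_norm_le.2 hc_norm

theorem exists_isSignTree_approximation [IsFiniteMeasure μ]
    (Φ : HilbertBasis ι ℝ (Lp ℝ 2 μ)) {r : ℕ → Ω → ℝ} (hr : IsWeaklyNullSignSequence μ r)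
    {ε : ℝ≥0} (hε : 0 < ε) (k : ℕ) {E : Set Ω} (hE : MeasurableSet E) (F : Finset ι) :
    ∃ (L : List (Ω → ℝ)) (P : List (ι →₀ ℝ)), IsSignTree k E L ∧
      List.Forall₂ (IsContractiveApproximation Φ ε) P L ∧
      P.Pairwise (Disjoint on Finsupp.support) ∧ ∀ c ∈ P, Disjoint c.support F := by
  classical
  induction k generalizing E F with
  | zero => exact ⟨[], [], .nil E, .nil, .nil, by simp⟩
  | succ k ih =>
    obtain ⟨n, c, hcF, hc⟩ := exists_isContractiveApproximation_indicator Φ hr hE F hε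
    have hset : MeasurableSet (r n ⁻¹' {1}) := hr.measurable n (measurableSet_singleton 1)
    obtain ⟨L₁, P₁, hL₁, hnear₁, hdisj₁, hF₁⟩ := ih (hE.diff hset) (c.support ∪ F)
    obtain ⟨L₂, P₂, hL₂, hnear₂, hdisj₂, hF₂⟩ :=
      ih (hE.inter hset) (P₁.sum.support ∪ (c.support ∪ F))
    simp only [Finset.disjoint_union_right] at hF₁ hF₂
    have hP₁P₂ : ∀ a ∈ P₁, ∀ b ∈ P₂, Disjoint a.support b.support := fun a ha b hb =>
      (Finset.disjoint_of_subset_right (support_subset_support_list_sum hdisj₁ ha)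
        (hF₂ b hb).1).symm
    refine ⟨L₁ ++ E.indicator (r n) :: L₂, P₁ ++ c :: P₂,
      .node (hr.measurable n) (hr.eq_one_or_eq_neg_one n) hL₁ hL₂,
      List.rel_append hnear₁ (.cons hc hnear₂), ?_, ?_⟩
    · refine List.pairwise_append.2 ⟨hdisj₁, List.pairwise_cons.2 ⟨fun b hb => ?_, hdisj₂⟩, ?_⟩
      · exact (hF₂ b hb).2.1.symm
      · exact fun a ha => List.forall_mem_cons.2 ⟨(hF₁ a ha).1, hP₁P₂ a ha⟩
    · exact List.forall_mem_append.2 ⟨fun a ha => (hF₁ a ha).2,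
        List.forall_mem_cons.2 ⟨hcF, fun b hb => (hF₂ b hb).2.2⟩⟩

lemma enorm_sq_linearCombination_list_sum_le {Φ : ι → Lp ℝ 2 μ} (hΦ : Orthonormal ℝ Φ)
    {ε : ℝ≥0} {P : List (ι →₀ ℝ)} {L : List (Ω → ℝ)}
    (hP : P.Pairwise (Disjoint on Finsupp.support))
    (h : List.Forall₂ (IsContractiveApproximation Φ ε) P L) :
    ‖linearCombination ℝ Φ P.sum‖ₑ ^ 2 ≤ (L.map fun f => eLpNorm f 2 μ ^ 2).sum := by
  rw [enorm_sq_linearCombination_list_sum hΦ hP]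
  refine List.Forall₂.sum_le_sum ?_
  rw [List.forall₂_map_left_iff, List.forall₂_map_right_iff]
  refine h.imp fun c f hcf => ?_
  rw [Lp.enorm_def]
  gcongr
  exact hcf.eLpNorm_le

lemma exists_enorm_sum_take_sub_le {Φ : ι → Lp ℝ 2 μ} {ε : ℝ≥0} {P : List (ι →₀ ℝ)}
    {L : List (Ω → ℝ)} (h : List.Forall₂ (IsContractiveApproximation Φ ε) P L) :
    ∃ D : Ω → ℝ≥0∞, AEStronglyMeasurable D μ ∧ eLpNorm D 2 μ ≤ L.length * ε ∧
      ∀ᵐ x ∂μ, ∀ m, ‖linearCombination ℝ Φ (P.take m).sum x - (L.take m).sum x‖ₑ ≤ D x := by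
  induction h with
  | nil =>
    refine ⟨0, aestronglyMeasurable_zero, by simp, ?_⟩
    filter_upwards [AEEqFun.coeFn_zero (μ := μ) (β := ℝ)] with x hx m
    simp [hx]
  | @cons c f P L hcf _ ih =>
    obtain ⟨D, hD_meas, hD_norm, hD⟩ := ih
    have hmeas : AEStronglyMeasurable (fun x => ‖(linearCombination ℝ Φ c - f : Ω → ℝ) x‖ₑ) μ :=
      ((Lp.aestronglyMeasurable _).sub hcf.aestronglyMeasurable).enorm.aestronglyMeasurable
    refine ⟨_, hmeas.add hD_meas, (eLpNorm_add_le hmeas hD_meas one_le_two).trans ?_, ?_⟩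
    · rw [eLpNorm_enorm, List.length_cons, Nat.cast_succ, add_one_mul, add_comm]
      exact add_le_add hD_norm hcf.eLpNorm_sub_le
    · have hadd : ∀ᵐ x ∂μ, ∀ m, linearCombination ℝ Φ (c + (P.take m).sum) x =
          linearCombination ℝ Φ c x + linearCombination ℝ Φ (P.take m).sum x :=
        ae_all_iff.2 fun m => by rw [map_add]; exact Lp.coeFn_add _ _
      filter_upwards [hD, hadd, AEEqFun.coeFn_zero (μ := μ) (β := ℝ)] with x hDx haddx hzero m
      cases m with
      | zero => simp [hzero]
      | succ m =>
        rw [List.take_succ_cons, List.take_succ_cons, List.sum_cons, List.sum_cons, haddx,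
          Pi.add_apply, add_sub_add_comm]
        exact (enorm_add_le _ _).trans (add_le_add_right (hDx m) _)

theorem le_eLpNorm_maximalPartialSum_add [IsProbabilityMeasure μ] {Φ : ι → Lp ℝ 2 μ}
    {ε : ℝ≥0} {k : ℕ} {P : List (ι →₀ ℝ)} {L : List (Ω → ℝ)} (hL : IsSignTree k Set.univ L)
    (h : List.Forall₂ (IsContractiveApproximation Φ ε) P L) :
    (k / 3 : ℝ≥0∞) ≤ eLpNorm (maximalPartialSum Φ P) 2 μ + L.length * ε := by
  obtain ⟨D, hD_meas, hD_norm, hD⟩ := exists_enorm_sum_take_sub_le h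
  have hpointwise : ∀ᵐ x ∂μ, (k / 3 : ℝ≥0∞) ≤ (maximalPartialSum Φ P + D) x := by
    filter_upwards [hD] with x hDx
    refine (hL.le_iSup_enorm_sum_take_apply (Set.mem_univ x)).trans (iSup_le fun m => ?_)
    set p := linearCombination ℝ Φ (P.take m).sum x
    calc ‖(L.take m).sum x‖ₑ = ‖p - (p - (L.take m).sum x)‖ₑ := by rw [sub_sub_cancel]
      _ ≤ ‖p‖ₑ + ‖p - (L.take m).sum x‖ₑ := enorm_sub_le
      _ ≤ maximalPartialSum Φ P x + D x :=
        add_le_add (le_iSup (fun m => ‖linearCombination ℝ Φ (P.take m).sum x‖ₑ) m) (hDx m)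
  calc (k / 3 : ℝ≥0∞) = eLpNorm (fun _ => (k / 3 : ℝ≥0∞)) 2 μ := by
        simp [eLpNorm_const' (μ := μ) (k / 3 : ℝ≥0∞) two_ne_zero ENNReal.ofNat_ne_top]
    _ ≤ eLpNorm (maximalPartialSum Φ P + D) 2 μ := eLpNorm_mono_enorm_ae hpointwise
    _ ≤ eLpNorm (maximalPartialSum Φ P) 2 μ + eLpNorm D 2 μ :=
        eLpNorm_add_le (measurable_maximalPartialSum Φ P).aestronglyMeasurable hD_meas one_le_two
    _ ≤ eLpNorm (maximalPartialSum Φ P) 2 μ + L.length * ε := by gcongr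

theorem exists_le_eLpNorm_maximalPartialSum_add [IsProbabilityMeasure μ]
    (Φ : HilbertBasis ι ℝ (Lp ℝ 2 μ)) {r : ℕ → Ω → ℝ} (hr : IsWeaklyNullSignSequence μ r) (k : ℕ)
    {δ : ℝ≥0} (hδ : 0 < δ) :
    ∃ P : List (ι →₀ ℝ), P.Pairwise (Disjoint on Finsupp.support) ∧ P.length < 2 ^ k ∧
      ‖linearCombination ℝ Φ P.sum‖ₑ ^ 2 ≤ k ∧
      (k / 3 : ℝ≥0∞) ≤ eLpNorm (maximalPartialSum Φ P) 2 μ + δ := by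
  obtain ⟨L, P, hL, hPL, hP, -⟩ :=
    exists_isSignTree_approximation Φ hr (ε := δ / 2 ^ k) (by positivity) k .univ ∅
  have hlength : L.length < 2 ^ k := hL.length_add_one ▸ Nat.lt_succ_self L.length
  have herror : (L.length * (δ / 2 ^ k : ℝ≥0) : ℝ≥0∞) ≤ δ := by
    have hreal : (L.length : ℝ≥0) * (δ / 2 ^ k) ≤ δ := by
      rw [mul_div_left_comm]
      exact mul_le_of_le_one_right' ((div_le_one₀ (by positivity)).2 (mod_cast hlength.le))
    exact_mod_cast hreal
  refine ⟨P, hP, hPL.length_eq ▸ hlength, ?_, ?_⟩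
  · refine (enorm_sq_linearCombination_list_sum_le Φ.orthonormal hP hPL).trans_eq ?_
    rw [hL.sum_eLpNorm_sq μ .univ, measure_univ, mul_one]
  · exact (le_eLpNorm_maximalPartialSum_add hL hPL).trans (by gcongr)

end Approximation

section Rademacher

lemma intervalIntegral_eq_zero_of_periodic_of_antiperiodic {E : Type*} [NormedAddCommGroup E]
    [NormedSpace ℝ E] {f : ℝ → E} {T c : ℝ} (hT : f.Periodic T) (hc : f.Antiperiodic c) :
    ∫ x in (0)..T, f x = 0 := by
  have : IsAddTorsionFree E := .of_isTorsionFree ℝ E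
  refine self_eq_neg.1 ?_
  calc ∫ x in (0)..T, f x = ∫ x in c..c + T, f x := by
        simpa using hT.intervalIntegral_add_eq 0 c
    _ = ∫ x in (0)..T, f (x + c) := by
        rw [intervalIntegral.integral_comp_add_right, zero_add, add_comm T]
    _ = -∫ x in (0)..T, f x := by simp only [hc _, intervalIntegral.integral_neg]

lemma fract_add_half_lt_half_iff {R : Type*} [Field R] [LinearOrder R] [IsStrictOrderedRing R]
    [FloorRing R] (y : R) : Int.fract (y + 1 / 2) < 1 / 2 ↔ ¬Int.fract y < 1 / 2 := by
  have h₀ := Int.fract_nonneg y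
  have h₁ := Int.fract_lt_one y
  have hy := Int.floor_add_fract y
  by_cases h : Int.fract y < 1 / 2
  · have hfract : Int.fract (y + 1 / 2) = Int.fract y + 1 / 2 :=
      Int.fract_eq_iff.2 ⟨by linarith, by linarith, ⌊y⌋, by linarith⟩
    simp only [hfract, h, not_true, iff_false]
    linarith
  · have hfract : Int.fract (y + 1 / 2) = Int.fract y - 1 / 2 :=
      Int.fract_eq_iff.2 ⟨by linarith, by linarith, ⌊y⌋ + 1, by push_cast; linarith⟩
    simp only [hfract, h, not_false_iff, iff_true]
    linarith

/-- The `M`-th Rademacher function, extended to the real line with period `1`. -/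
noncomputable def rademacher (M : ℕ) (x : ℝ) : ℝ :=
  if Int.fract (2 ^ M * x) < 1 / 2 then 1 else -1

lemma measurable_rademacher (M : ℕ) : Measurable (rademacher M) :=
  Measurable.ite (measurableSet_lt (by fun_prop) measurable_const) measurable_const
    measurable_const

lemma rademacher_eq_one_or_eq_neg_one (M : ℕ) (x : ℝ) :
    rademacher M x = 1 ∨ rademacher M x = -1 := by
  unfold rademacher
  split_ifs <;> simp

lemma antiperiodic_rademacher (M : ℕ) : (rademacher M).Antiperiodic (1 / 2 ^ (M + 1)) := by
  intro x
  have hx : (2 : ℝ) ^ M * (x + 1 / 2 ^ (M + 1)) = 2 ^ M * x + 1 / 2 := by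
    field_simp
    ring
  simp only [rademacher, hx, fract_add_half_lt_half_iff, ite_not]
  split_ifs <;> simp

lemma periodic_rademacher {m M : ℕ} (h : m ≤ M) : (rademacher M).Periodic (1 / 2 ^ m) := by
  intro x
  obtain ⟨d, rfl⟩ := Nat.exists_eq_add_of_le h
  have hx : (2 : ℝ) ^ (m + d) * (x + 1 / 2 ^ m) = 2 ^ (m + d) * x + (2 ^ d : ℕ) := by
    push_cast
    field_simp
    ring
  simp only [rademacher, hx, Int.fract_add_natCast]

instance : IsProbabilityMeasure muUnit := ⟨by simp [muUnit]⟩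

lemma integral_rademacher_mul_rademacher_of_lt {M K : ℕ} (h : M < K) :
    ∫ x, rademacher M x * rademacher K x ∂muUnit = 0 := by
  have hone (m : ℕ) : (rademacher m).Periodic 1 := by simpa using periodic_rademacher m.zero_le
  have hanti : (rademacher M * rademacher K).Antiperiodic (1 / 2 ^ (M + 1)) := fun x => by
    simp only [Pi.mul_apply, antiperiodic_rademacher M x, periodic_rademacher h x, neg_mul]
  rw [← integral_Ioc_eq_integral_Ioo, ← intervalIntegral.integral_of_le zero_le_one]
  exact intervalIntegral_eq_zero_of_periodic_of_antiperiodic ((hone M).mul (hone K)) hanti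

lemma memLp_rademacher (M : ℕ) : MemLp (rademacher M) 2 muUnit :=
  MemLp.of_bound (measurable_rademacher M).aestronglyMeasurable 1 <| ae_of_all _ fun x => by
    rcases rademacher_eq_one_or_eq_neg_one M x with h | h <;> simp [h]

lemma orthonormal_rademacher : Orthonormal ℝ fun M => (memLp_rademacher M).toLp := by
  refine orthonormal_iff_ite.2 fun M K => ?_
  rw [inner_toLp_toLp]
  rcases lt_trichotomy M K with h | rfl | h
  · rw [if_neg h.ne, integral_rademacher_mul_rademacher_of_lt h]
  · have hsq (x : ℝ) : rademacher M x * rademacher M x = 1 :=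
      mul_self_eq_one_iff.2 (rademacher_eq_one_or_eq_neg_one M x)
    simp [hsq]
  · simp only [if_neg h.ne', mul_comm (rademacher M _), integral_rademacher_mul_rademacher_of_lt h]

lemma isWeaklyNullSignSequence_rademacher : IsWeaklyNullSignSequence muUnit rademacher where
  measurable := measurable_rademacher
  eq_one_or_eq_neg_one := rademacher_eq_one_or_eq_neg_one
  tendsto_integral_mul g hg := by
    simpa only [inner_toLp_toLp, Nat.cofinite_eq_atTop] using
      tendsto_inner_cofinite_of_orthonormal orthonormal_rademacher (hg.toLp g)

end Rademacher

section Kappa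

variable {Φ : ℕ → L2Unit} {P : List (ℕ →₀ ℝ)} {n : ℕ}

lemma phiPolynomial_sum_support_sum_take (Φ : ℕ → L2Unit)
    (hP : P.Pairwise (Disjoint on Finsupp.support)) (m : ℕ) :
    phiPolynomial Φ P.sum (P.take m).sum.support = linearCombination ℝ Φ (P.take m).sum := by
  rw [linearCombination_apply]
  exact Finset.sum_congr rfl fun j hj => by rw [sum_apply_of_mem_support_sum_take hP hj]

lemma maximalPartialSum_le_maximalFunction (Φ : ℕ → L2Unit)
    (hP : P.Pairwise (Disjoint on Finsupp.support)) (hn : P.length < n) (x : ℝ) :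
    maximalPartialSum Φ P x ≤ maximalFunction n
      (fun k => phiPolynomial Φ P.sum (P.take (k - 1)).sum.support) x := by
  refine iSup_le fun m => ?_
  have hm : P.take m = P.take (min m P.length + 1 - 1) := by
    rw [Nat.add_sub_cancel, ← List.take_eq_take_min]
  rw [hm, ← phiPolynomial_sum_support_sum_take Φ hP]
  exact le_iSup₂ (f := fun k (_ : k ∈ Finset.Icc 1 n) =>
      ‖phiPolynomial Φ P.sum (P.take (k - 1)).sum.support x‖ₑ) (min m P.length + 1)
    (Finset.mem_Icc.2 ⟨by lia, by lia⟩)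

lemma isMonotonicData_support_sum_take (hP : P.Pairwise (Disjoint on Finsupp.support))
    (hn : P.length < n) (hsum : P.sum ≠ 0) :
    IsMonotonicData n (fun k => (P.take (k - 1)).sum.support) P.sum := by
  refine ⟨fun k _ l _ hkl => monotone_support_sum_take hP (Nat.sub_le_sub_right hkl 1), ?_⟩
  beta_reduce
  rw [List.take_of_length_le (Nat.le_sub_one_of_lt hn)]
  exact (Finset.sum_pos (fun i hi => sq_pos_of_ne_zero (Finsupp.mem_support_iff.1 hi))
    (Finsupp.support_nonempty_iff.2 hsum)).ne'

lemma eLpNorm_maximalPartialSum_le_kappa_mul (hΦ : Orthonormal ℝ Φ)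
    (hP : P.Pairwise (Disjoint on Finsupp.support)) (hn : P.length < n) :
    eLpNorm (maximalPartialSum Φ P) 2 muUnit ≤
      kappa n Φ * ‖linearCombination ℝ Φ P.sum‖ₑ := by
  rcases eq_or_ne P.sum 0 with hsum | hsum
  · rw [eLpNorm_congr_ae (maximalPartialSum_ae_eq_zero Φ hP hsum), eLpNorm_zero]
    exact zero_le
  let G (k : ℕ) : Finset ℕ := (P.take (k - 1)).sum.support
  have hpn : phiPolynomial Φ P.sum (G n) = linearCombination ℝ Φ P.sum := by
    rw [phiPolynomial_sum_support_sum_take Φ hP, List.take_of_length_le (Nat.le_sub_one_of_lt hn)]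
  have hne : ‖linearCombination ℝ Φ P.sum‖ₑ ≠ 0 := by
    rw [enorm_ne_zero]
    exact fun h => hsum (hΦ.linearIndependent (h.trans (map_zero _).symm))
  rw [← ENNReal.div_le_iff hne enorm_ne_top]
  calc eLpNorm (maximalPartialSum Φ P) 2 muUnit / ‖linearCombination ℝ Φ P.sum‖ₑ
      ≤ eLpNorm (maximalFunction n fun k => phiPolynomial Φ P.sum (G k)) 2 muUnit /
          eLpNorm (phiPolynomial Φ P.sum (G n)) 2 muUnit := by
        rw [hpn, Lp.enorm_def]
        gcongr
        exact eLpNorm_mono_enorm fun x => maximalPartialSum_le_maximalFunction Φ hP hn x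
    _ ≤ kappa n Φ := le_iSup₂_of_le G P.sum <|
        le_iSup_of_le (isMonotonicData_support_sum_take hP hn hsum) le_rfl

lemma IsCompleteOrthonormalSystem.exists_hilbertBasis (hΦ : IsCompleteOrthonormalSystem Φ) :
    ∃ b : HilbertBasis ℕ ℝ L2Unit, ⇑b = Φ :=
  ⟨.mk hΦ.orthonormal hΦ.complete.ge, HilbertBasis.coe_mk _ _⟩

lemma IsCompleteOrthonormalSystem.le_kappa_mul_sqrt (hΦ : IsCompleteOrthonormalSystem Φ) {k : ℕ}
    (hn : 2 ^ k ≤ n) : (k / 3 : ℝ≥0∞) ≤ kappa n Φ * ENNReal.ofReal √k := by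
  obtain ⟨b, rfl⟩ := hΦ.exists_hilbertBasis
  refine ENNReal.le_of_forall_pos_le_add fun δ hδ _ => ?_
  obtain ⟨P, hP, hlength, hnorm, hmax⟩ :=
    exists_le_eLpNorm_maximalPartialSum_add b isWeaklyNullSignSequence_rademacher k hδ
  have hnorm_le_sqrt : ‖linearCombination ℝ b P.sum‖ₑ ≤ ENNReal.ofReal √k := by
    rw [← ENNReal.pow_le_pow_left_iff two_ne_zero, ← ENNReal.ofReal_pow (Real.sqrt_nonneg _),
      Real.sq_sqrt k.cast_nonneg, ENNReal.ofReal_natCast]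
    exact hnorm
  calc (k / 3 : ℝ≥0∞) ≤ eLpNorm (maximalPartialSum b P) 2 muUnit + δ := hmax
    _ ≤ kappa n b * ‖linearCombination ℝ b P.sum‖ₑ + δ := by
        gcongr
        exact eLpNorm_maximalPartialSum_le_kappa_mul b.orthonormal hP (hlength.trans_le hn)
    _ ≤ kappa n b * ENNReal.ofReal √k + δ := by gcongr

theorem IsCompleteOrthonormalSystem.sqrt_div_three_le_kappa (hΦ : IsCompleteOrthonormalSystem Φ)
    {k : ℕ} (hn : 2 ^ k ≤ n) : ENNReal.ofReal (√k / 3) ≤ kappa n Φ := by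
  rcases k.eq_zero_or_pos with rfl | hk
  · simp
  have hsqrt : 0 < √(k : ℝ) := by positivity
  calc ENNReal.ofReal (√k / 3) = ENNReal.ofReal (k / 3 / √k) := by
        rw [div_right_comm, Real.div_sqrt]
    _ = (k / 3 : ℝ≥0∞) / ENNReal.ofReal √k := by
        rw [ENNReal.ofReal_div_of_pos hsqrt, ENNReal.ofReal_div_of_pos three_pos,
          ENNReal.ofReal_natCast, ENNReal.ofReal_ofNat]
    _ ≤ kappa n Φ := ENNReal.div_le_of_le_mul (hΦ.le_kappa_mul_sqrt hn)

lemma sqrt_logb_two_le (hn : 2 ≤ n) : √(Real.logb 2 n) ≤ 2 * √(Nat.log 2 n) := by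
  have hk : (1 : ℝ) ≤ Nat.log 2 n := mod_cast Nat.log_pos one_lt_two hn
  have hlog : Real.logb 2 n ≤ Nat.log 2 n + 1 := by
    rw [Real.logb_le_iff_le_rpow one_lt_two (by positivity)]
    exact_mod_cast (Nat.lt_pow_succ_log_self one_lt_two n).le
  rw [Real.sqrt_le_left (by positivity), mul_pow, Real.sq_sqrt (by positivity)]
  linarith

end Kappa

theorem mainTheorem3 :
    ∃ C : ℝ, 0 < C ∧
      ∀ Φ : ℕ → L2Unit, IsCompleteOrthonormalSystem Φ →
        ∀ n : ℕ, 1 ≤ n →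
          ENNReal.ofReal (C * Real.sqrt (Real.logb 2 n)) ≤ kappa n Φ := by
  refine ⟨1 / 6, by norm_num, fun Φ hΦ n hn => ?_⟩
  rcases hn.eq_or_lt with rfl | hn
  · simp
  calc ENNReal.ofReal (1 / 6 * √(Real.logb 2 n)) ≤ ENNReal.ofReal (√(Nat.log 2 n) / 3) :=
        ENNReal.ofReal_le_ofReal (by linarith [sqrt_logb_two_le hn])
    _ ≤ kappa n Φ := hΦ.sqrt_div_three_le_kappa (Nat.pow_log_le_self 2 (by lia))
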